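/- Let $G$ be a loop-free directed graph on $\{1,\dots,d\}$ with irreducible incidence matrix, and let $A=(a_{ij})$ be a matrix with $a_{ij}>0$ if $(i,j)$ is an edge, $a_{ij}=0$ otherwise, and $\sum_j a_{ij}=1$ for every $i$. Let $\beta>0$, $\gamma\in(0,\infty)^d$, $\mu\in\mathbb R^d$, let $\Sigma$ be a symmetric positive definite $d\times d$ matrix and $W$ a $d\times d$ matrix with $WW^{T}=\Sigma$. The demand vector is $D=\mu+RW\Psi\sim N(\mu,\Sigma)$, where $R\ge 0$, $R^2\sim\Gamma(d/2,1/2)$ (chi-square with $d$ degrees of freedom), $\Psi=z/\|z\|$ with $z\sim N(0,I)$ (so that $\Psi$ is uniform on the unit sphere), and $R,\Psi$ are independent. For $n\in\mathbb N$ let $L_n(D)\in[0,\infty]$ be the optimal value of the linear program $$\max\{\,y'(D-n^{\beta}\gamma)\;:\;(I-A)y\le \mathbf 1,\ y\ge 0\,\},$$ let $k_n\ge 0$ with $k_n=o(n^{\beta})$, and for $\|\psi\|=1$ put $T_n(\psi)=P\{L_n(\mu+RW\psi)>k_n\}$. Then $T_n(\Psi)=P\{L_n(D)>k_n\mid\Psi\}$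 almost surely, and the following hold. (a) There exist $n_0>0$, $c_3>0$, $s^*>0$, and sequences $\eta_1(n)=O(n^{\beta})$ and $\eta_2(n)=O(1)$ such that for all $n>n_0$ $$T_n(\psi)\le P\{R>n^{\beta}s^*+\eta_1(n)\}\quad\text{for all }\|\psi\|=1,\qquad (1)$$ $$P\{L_n(D)>k_n\}\ge c_3\,P\{R>n^{\beta}s^*+\eta_2(n)\}\,n^{-(d-1)\beta}.\qquad (2)$$ (b) Moreover, $n_0$, $c_3$, $s^*>0$, $\eta_1$ and $\eta_2$ can be chosen so that (1) and (2) hold for all $n>n_0$ with $\eta_1(n)=O(1+k_n)$ and $\eta_2(n)=O(1+k_n)$. In particular both error terms are then $o(n^\beta)$, and they are $O(1)$ if $(k_n)$ is bounded. (c) The estimator $T_n(\Psi)$ of $P\{L_n(D)>k_n\}>0$ is asymptotically optimal: $E[T_n(\Psi)]=P\{L_n(D)>k_n\}$ for every $n$, and for every $\varepsilon>0$ $$\sup_{n>0}\frac{E[T_n(\Psi)^2]}{P\{L_n(D)>k_n\}^{2-\varepsilon}}<\infty .$$ -/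

import Mathlib

open MeasureTheory ProbabilityTheory Filter Asymptotics
open scoped Matrix

/-- A distribution network on the vertices `Fin d`: a loop-free irreducible directed graph,
together with the proportions `A i j` of the unserved demand of `i` that is sent to `j`. -/
structure DistributionNetwork (d : ℕ) where
  /-- The incidence matrix of the graph. -/
  H : Matrix (Fin d) (Fin d) ℝ
  /-- The matrix of the proportions. -/
  A : Matrix (Fin d) (Fin d) ℝ
  H_zero_or_one : ∀ i j, H i j = 0 ∨ H i j = 1
  H_diag : ∀ i, H i i = 0
  H_irreducible : H.IsIrreducible
  A_eq_zero : ∀ i j, H i j = 0 → A i j = 0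
  A_pos : ∀ i j, H i j = 1 → 0 < A i j
  A_row_sum : ∀ i, ∑ j, A i j = 1

/-- The feasible region `{y | (I - A) y ≤ 1, y ≥ 0}` of the dual linear program. -/
def DistributionNetwork.dualFeasible {d : ℕ} (N : DistributionNetwork d) : Set (Fin d → ℝ) :=
  {y | (1 - N.A) *ᵥ y ≤ 1 ∧ 0 ≤ y}

/-- The optimal value of the dual linear program `max {y' r | (I - A) y ≤ 1, y ≥ 0}`, where
`r` is the vector of the demands minus the supplies. It is `⊤` if the program is unbounded. -/
noncomputable def DistributionNetwork.dualValue {d : ℕ} (N : DistributionNetwork d)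
    (r : Fin d → ℝ) : EReal :=
  ⨆ y ∈ N.dualFeasible, ((y ⬝ᵥ r : ℝ) : EReal)

/-- The supplies `s_n(t_i) = n ^ β γ(t_i)`. -/
noncomputable def supply {d : ℕ} (β : ℝ) (γ : Fin d → ℝ) (n : ℕ) : Fin d → ℝ :=
  fun i => (n : ℝ) ^ β * γ i

/-- `L_n(D)`: the optimal value of the dual program for the rarity parameter `n`
and the demand vector `D`. -/
noncomputable def DistributionNetwork.cost {d : ℕ} (N : DistributionNetwork d)
    (β : ℝ) (γ : Fin d → ℝ) (n : ℕ) (D : Fin d → ℝ) : EReal :=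
  N.dualValue (D - supply β γ n)

/-- The demand vector `μ + r W ψ` with radius `r` and angle `ψ`. -/
noncomputable def polarDemand {d : ℕ} (μ : Fin d → ℝ) (W : Matrix (Fin d) (Fin d) ℝ)
    (r : ℝ) (ψ : EuclideanSpace ℝ (Fin d)) : Fin d → ℝ :=
  μ + r • (W *ᵥ ψ.ofLp)

/-- The angle `z / ‖z‖` of a vector. -/
noncomputable def angle {d : ℕ} (z : EuclideanSpace ℝ (Fin d)) : EuclideanSpace ℝ (Fin d) :=
  ‖z‖⁻¹ • z

/-- The law of the polar coordinates `(R, z / ‖z‖)` of a standard Gaussian vector of `ℝ ^ d`: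
`R ≥ 0`, `R ^ 2` has the Gamma distribution of shape `d / 2` and rate `1 / 2` (that is, the
chi-square distribution with `d` degrees of freedom), `z` is standard Gaussian, so that
`z / ‖z‖` is uniform on the unit sphere, and `R` and `z / ‖z‖` are independent. -/
structure IsPolarPair {d : ℕ} {Ω : Type*} [MeasurableSpace Ω] (P : Measure Ω)
    (R : Ω → ℝ) (z : Ω → EuclideanSpace ℝ (Fin d)) : Prop where
  measurable_radius : Measurable R
  measurable_gauss : Measurable z
  radius_nonneg : ∀ᵐ ω ∂P, 0 ≤ R ω
  radius_law : HasLaw (fun ω => R ω ^ 2) (gammaMeasure ((d : ℝ) / 2) (1 / 2)) P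
  gauss_law : HasLaw z (stdGaussian (EuclideanSpace ℝ (Fin d))) P
  indep : IndepFun R (fun ω => angle (z ω)) P

/-- The probability that `L_n(μ + R W ψ) > k_n`, where the angle `ψ` is fixed and
only the radius `R` is random. -/
noncomputable def condFailureProb {d : ℕ} {Ω : Type*} [MeasurableSpace Ω]
    (N : DistributionNetwork d) (β : ℝ) (γ μ : Fin d → ℝ) (W : Matrix (Fin d) (Fin d) ℝ)
    (k : ℕ → ℝ) (P : Measure Ω) (R : Ω → ℝ) (n : ℕ) (ψ : EuclideanSpace ℝ (Fin d)) : ℝ :=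
  P.real {ω | (k n : EReal) < N.cost β γ n (polarDemand μ W (R ω) ψ)}

/-- The failure event `{L_n(D) > k_n}` for the random demand `D = μ + R W (z / ‖z‖)`. -/
def failureEvent {d : ℕ} {Ω : Type*}
    (N : DistributionNetwork d) (β : ℝ) (γ μ : Fin d → ℝ) (W : Matrix (Fin d) (Fin d) ℝ)
    (k : ℕ → ℝ) (R : Ω → ℝ) (z : Ω → EuclideanSpace ℝ (Fin d)) (n : ℕ) : Set Ω :=
  {ω | (k n : EReal) < N.cost β γ n (polarDemand μ W (R ω) (angle (z ω)))}

/-- The square integrable estimators `Z n` of the numbers `ρ n > 0` are asymptotically optimal: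
`E[Z n] = ρ n`, and `sup_{n > 0} E[Z n ^ 2] / ρ n ^ (2 - ε) < ∞` for every `ε > 0`. -/
def AsymptoticallyOptimal {Ω : Type*} [MeasurableSpace Ω] (P : Measure Ω)
    (Z : ℕ → Ω → ℝ) (ρ : ℕ → ℝ) : Prop :=
  (∀ n, 0 < ρ n) ∧ (∀ n, MemLp (Z n) 2 P) ∧ (∀ n, ∫ ω, Z n ω ∂P = ρ n) ∧
    ∀ ε : ℝ, 0 < ε →
      ∃ C : ℝ, ∀ n : ℕ, 0 < n → (∫ ω, Z n ω ^ 2 ∂P) / ρ n ^ (2 - ε) ≤ C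

/-! For a dual vector `y`, the objective at `μ + r W ψ` is `y·μ + r ⟨Wᵀy, ψ⟩ - n^β y·γ`. Writing `l
= Wᵀy`, a positive value forces `r` up to an additive constant above `n^β (y·γ) / ‖l‖`, and this
quotient is unchanged when `y` is scaled. Its minimum `s` over nonzero `y ≥ 0` is the critical
radius per unit of `n^β` (`exists_critical`).

Upper bound: by Cauchy-Schwarz no direction `ψ` can fail before radius `n^β s - ‖W⁻¹μ‖`
(`lt_radius_of_lt_cost`). Lower bound: take a feasible minimizer `y` and directions in a cap of size
`t` around `l / ‖l‖`. Misalignment costs only a factor `1 + d t²` in the radius, so `t = n^(-β)`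
changes the critical radius by `O(1)`, while the cap has probability of order at least `n^(-(d-1)β)`
(`exists_le_stdGaussian_cap`). Independence of radius and angle multiplies the two
(`exists_failure_bounds`).

Optimality: both bounds are radial tails at `n^β s + o(n^β)`, and these are `exp(-(1 + o(1)) (n^β
s)² / 2)`. The polynomial cap factor is negligible at this scale, so the second moment, at most the
squared upper bound, is dominated by the power `2 - ε` of the lower bound
(`exists_tail_sq_le_rpow`). -/

/-- The coefficient vector of the angle in the linear functional `y ⬝ᵥ (W *ᵥ ψ)`. -/
noncomputable def loading {d : ℕ} (W : Matrix (Fin d) (Fin d) ℝ) (y : Fin d → ℝ) :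
    EuclideanSpace ℝ (Fin d) :=
  WithLp.toLp 2 (Wᵀ *ᵥ y)

/-! ### Deterministic part: the dual program and its critical radius -/

section Network

variable {d : ℕ}

lemma dotProduct_mulVec_eq_inner_loading (W : Matrix (Fin d) (Fin d) ℝ) (y : Fin d → ℝ)
    (ψ : EuclideanSpace ℝ (Fin d)) :
    y ⬝ᵥ (W *ᵥ ψ.ofLp) = inner ℝ (loading W y) ψ := by
  rw [EuclideanSpace.inner_eq_star_dotProduct, loading, Matrix.dotProduct_mulVec,
    Matrix.mulVec_transpose, dotProduct_comm]
  simp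

lemma loading_smul (W : Matrix (Fin d) (Fin d) ℝ) (c : ℝ) (y : Fin d → ℝ) :
    loading W (c • y) = c • loading W y := by
  simp [loading, Matrix.mulVec_smul]

lemma continuous_loading (W : Matrix (Fin d) (Fin d) ℝ) : Continuous (loading W) := by
  unfold loading
  fun_prop

lemma loading_ne_zero {W : Matrix (Fin d) (Fin d) ℝ} (hW : IsUnit W) {y : Fin d → ℝ}
    (hy : y ≠ 0) : loading W y ≠ 0 := by
  intro h
  apply hy
  have h' : Wᵀ *ᵥ y = 0 := by simpa [loading] using h
  have hWT : IsUnit Wᵀ := by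
    rw [Matrix.isUnit_iff_isUnit_det, Matrix.det_transpose]
    exact (Matrix.isUnit_iff_isUnit_det _).mp hW
  exact Matrix.mulVec_injective_of_isUnit hWT (by simpa using h')

lemma dotProduct_polarDemand_sub_supply (β : ℝ) (γ μ : Fin d → ℝ)
    (W : Matrix (Fin d) (Fin d) ℝ) (n : ℕ) (r : ℝ) (ψ : EuclideanSpace ℝ (Fin d))
    (y : Fin d → ℝ) :
    y ⬝ᵥ (polarDemand μ W r ψ - supply β γ n) =
      y ⬝ᵥ μ + r * inner ℝ (loading W y) ψ - (n : ℝ) ^ β * (y ⬝ᵥ γ) := by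
  have h : supply β γ n = ((n : ℝ) ^ β) • γ := rfl
  rw [h, polarDemand, dotProduct_sub, dotProduct_add, dotProduct_smul, dotProduct_smul,
    dotProduct_mulVec_eq_inner_loading]
  simp

namespace DistributionNetwork

lemma lt_cost_iff (N : DistributionNetwork d) (β : ℝ) (γ : Fin d → ℝ) (n : ℕ) (D : Fin d → ℝ)
    (k : ℝ) :
    (k : EReal) < N.cost β γ n D ↔
      ∃ y ∈ N.dualFeasible, k < y ⬝ᵥ (D - supply β γ n) := by
  simp only [cost, dualValue, lt_iSup_iff, EReal.coe_lt_coe_iff, exists_prop]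

lemma A_nonneg (N : DistributionNetwork d) (i j : Fin d) : 0 ≤ N.A i j := by
  rcases N.H_zero_or_one i j with h | h
  · exact (N.A_eq_zero i j h).ge
  · exact (N.A_pos i j h).le

/-- Since `A ≥ 0`, each coordinate of `(I - A) y` is at most `∑ i, y i`. Hence the feasible set
meets every ray of the nonnegative orthant, and scale-invariant minimization may ignore the
constraint `(I - A) y ≤ 1`. -/
lemma exists_smul_mem_dualFeasible (N : DistributionNetwork d) {y : Fin d → ℝ} (hy : 0 ≤ y) :
    ∃ c : ℝ, 0 < c ∧ c • y ∈ N.dualFeasible := by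
  have hS : 0 ≤ ∑ i, y i := Finset.sum_nonneg fun i _ => hy i
  have hc : 0 < (1 + ∑ i, y i)⁻¹ := by positivity
  refine ⟨_, hc, fun i => ?_, smul_nonneg hc.le hy⟩
  have h1 : 0 ≤ (N.A *ᵥ y) i :=
    dotProduct_nonneg_of_nonneg (fun j => N.A_nonneg i j) hy
  have h2 : y i ≤ ∑ i, y i := Finset.single_le_sum (fun j _ => hy j) (Finset.mem_univ i)
  rw [Matrix.mulVec_smul, Matrix.sub_mulVec, Matrix.one_mulVec]
  simp only [Pi.smul_apply, Pi.sub_apply, smul_eq_mul, Pi.one_apply]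
  rw [inv_mul_le_iff₀ (by positivity)]
  linarith

/-- The minimal radius per unit of supply at which the demand can outgrow the supply is attained
at a feasible dual vector. -/
lemma exists_critical (N : DistributionNetwork d) (hd : 0 < d) {γ : Fin d → ℝ}
    (hγ : ∀ i, 0 < γ i) {W : Matrix (Fin d) (Fin d) ℝ} (hW : IsUnit W) :
    ∃ y ∈ N.dualFeasible, ∃ s : ℝ, 0 < s ∧ loading W y ≠ 0 ∧ y ⬝ᵥ γ = s * ‖loading W y‖ ∧
      ∀ y', 0 ≤ y' → s * ‖loading W y'‖ ≤ y' ⬝ᵥ γ := by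
  have hne : ∀ y ∈ stdSimplex ℝ (Fin d), y ≠ 0 := by
    rintro y hy rfl
    simpa using hy.2
  have hpos : ∀ y ∈ stdSimplex ℝ (Fin d), 0 < ‖loading W y‖ := fun y hy =>
    norm_pos_iff.mpr (loading_ne_zero hW (hne y hy))
  have hcont : ContinuousOn (fun y => (y ⬝ᵥ γ) / ‖loading W y‖) (stdSimplex ℝ (Fin d)) := by
    refine ContinuousOn.div ?_ (continuous_loading W).norm.continuousOn fun y hy => (hpos y hy).ne'
    unfold dotProduct
    fun_prop
  -- The quotient is homogeneous of degree 0, so a minimum on the compact simplex is a minimum over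
  -- all nonzero `y ≥ 0`.
  obtain ⟨y, hy, hmin⟩ := (isCompact_stdSimplex ℝ (Fin d)).exists_isMinOn
    ⟨_, single_mem_stdSimplex ℝ (⟨0, hd⟩ : Fin d)⟩ hcont
  have hyγ : 0 < y ⬝ᵥ γ := by
    obtain ⟨i, hi⟩ := Function.ne_iff.mp (hne y hy)
    exact Finset.sum_pos' (fun j _ => mul_nonneg (hy.1 j) (hγ j).le)
      ⟨i, Finset.mem_univ i, mul_pos ((hy.1 i).lt_of_ne' hi) (hγ i)⟩
  obtain ⟨c, hc, hcy⟩ := N.exists_smul_mem_dualFeasible (y := y) hy.1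
  refine ⟨c • y, hcy, _, div_pos hyγ (hpos y hy), ?_, ?_, fun y' hy' => ?_⟩
  · rw [loading_smul]
    exact smul_ne_zero hc.ne' (norm_pos_iff.mp (hpos y hy))
  · rw [loading_smul, norm_smul, smul_dotProduct, Real.norm_of_nonneg hc.le, smul_eq_mul]
    have := (hpos y hy).ne'
    field_simp
  · rcases eq_or_ne y' 0 with rfl | h0
    · simp [loading]
    have hS : 0 < ∑ i, y' i := by
      obtain ⟨i, hi⟩ := Function.ne_iff.mp h0
      exact Finset.sum_pos' (fun j _ => hy' j) ⟨i, Finset.mem_univ i, (hy' i).lt_of_ne' hi⟩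
    have hmem : (∑ i, y' i)⁻¹ • y' ∈ stdSimplex ℝ (Fin d) := by
      refine ⟨fun i => mul_nonneg (inv_nonneg.mpr hS.le) (hy' i), ?_⟩
      simp only [Pi.smul_apply, smul_eq_mul, ← Finset.mul_sum]
      exact inv_mul_cancel₀ hS.ne'
    have h := hmin hmem
    have hl : 0 < ‖loading W y'‖ := norm_pos_iff.mpr (loading_ne_zero hW h0)
    simp only [Set.mem_ofPred_eq, loading_smul, norm_smul, smul_dotProduct, smul_eq_mul] at h
    rw [Real.norm_of_nonneg (inv_nonneg.mpr hS.le),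
      mul_div_mul_left _ _ (inv_ne_zero hS.ne')] at h
    exact (le_div_iff₀ hl).mp h

/-- Since `y·μ = ⟨Wᵀy, W⁻¹μ⟩`, every term is controlled by a multiple of `‖Wᵀy‖`, which then
cancels. The shift is therefore uniform in `y`, although the feasible set is unbounded. -/
lemma lt_radius_of_lt_cost (N : DistributionNetwork d) {β s : ℝ} {γ : Fin d → ℝ}
    (μ : Fin d → ℝ) {W : Matrix (Fin d) (Fin d) ℝ} (hW : IsUnit W)
    (hs : ∀ y, 0 ≤ y → s * ‖loading W y‖ ≤ y ⬝ᵥ γ) {n : ℕ} {k r : ℝ} (hk : 0 ≤ k) (hr : 0 ≤ r)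
    {ψ : EuclideanSpace ℝ (Fin d)} (hψ : ‖ψ‖ ≤ 1)
    (h : (k : EReal) < N.cost β γ n (polarDemand μ W r ψ)) :
    (n : ℝ) ^ β * s - ‖WithLp.toLp 2 (W⁻¹ *ᵥ μ)‖ < r := by
  obtain ⟨y, hy, hlt⟩ := (N.lt_cost_iff ..).mp h
  rw [dotProduct_polarDemand_sub_supply] at hlt
  have hy0 : y ≠ 0 := by
    rintro rfl
    simp [loading] at hlt
    linarith
  have hl : 0 < ‖loading W y‖ := norm_pos_iff.mpr (loading_ne_zero hW hy0)
  have h1 : inner ℝ (loading W y) ψ ≤ ‖loading W y‖ :=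
    (real_inner_le_norm _ _).trans (mul_le_of_le_one_right hl.le hψ)
  have h2 : y ⬝ᵥ μ ≤ ‖loading W y‖ * ‖WithLp.toLp 2 (W⁻¹ *ᵥ μ)‖ := by
    have : y ⬝ᵥ μ = inner ℝ (loading W y) (WithLp.toLp 2 (W⁻¹ *ᵥ μ)) := by
      rw [← dotProduct_mulVec_eq_inner_loading, Matrix.mulVec_mulVec,
        Matrix.mul_nonsing_inv _ ((Matrix.isUnit_iff_isUnit_det _).mp hW), Matrix.one_mulVec]
    rw [this]
    exact real_inner_le_norm _ _
  have h3 := mul_le_mul_of_nonneg_left (hs y hy.2) (Real.rpow_nonneg (Nat.cast_nonneg n) β)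
  have h4 := mul_le_mul_of_nonneg_left h1 hr
  nlinarith

/-- One fixed `y` suffices as witness. The slack `(1 + |y·μ|)(1 + k)` pays for both the level `k`
and a negative `y·μ`. -/
lemma lt_cost_of_lt_radius (N : DistributionNetwork d) {β s : ℝ} {γ μ : Fin d → ℝ}
    {W : Matrix (Fin d) (Fin d) ℝ} {y : Fin d → ℝ} (hy : y ∈ N.dualFeasible)
    (hl : loading W y ≠ 0) (hs : y ⬝ᵥ γ = s * ‖loading W y‖)
    {n : ℕ} {k r τ : ℝ} (hk : 0 ≤ k) (hr : 0 ≤ r) (hτ : 0 ≤ τ)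
    {ψ : EuclideanSpace ℝ (Fin d)}
    (hψ : 1 ≤ (1 + τ) * inner ℝ (‖loading W y‖⁻¹ • loading W y) ψ)
    (h : (1 + τ) * ((n : ℝ) ^ β * s + (1 + |y ⬝ᵥ μ|) / ‖loading W y‖ * (1 + k)) < r) :
    (k : EReal) < N.cost β γ n (polarDemand μ W r ψ) := by
  refine (N.lt_cost_iff ..).mpr ⟨y, hy, ?_⟩
  rw [dotProduct_polarDemand_sub_supply, hs]
  have hl : 0 < ‖loading W y‖ := norm_pos_iff.mpr hl
  rw [real_inner_smul_left] at hψ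
  set l := ‖loading W y‖
  set p := inner ℝ (loading W y) ψ
  set m := y ⬝ᵥ μ
  have h1 : l ≤ (1 + τ) * p := by
    have := mul_le_mul_of_nonneg_left hψ hl.le
    have e : l * ((1 + τ) * (l⁻¹ * p)) = (1 + τ) * p := by field_simp
    linarith
  have h2 : (n : ℝ) ^ β * s * l + (1 + |m|) * (1 + k) < r * p := by
    have h3 : (1 + τ) * ((n : ℝ) ^ β * s * l + (1 + |m|) * (1 + k)) < (1 + τ) * (r * p) :=
      calc _ = (1 + τ) * ((n : ℝ) ^ β * s + (1 + |m|) / l * (1 + k)) * l := by field_simp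
        _ < r * l := by gcongr
        _ ≤ r * ((1 + τ) * p) := by gcongr
        _ = _ := by ring
    exact lt_of_mul_lt_mul_left h3 (by positivity)
  nlinarith [neg_abs_le m, abs_nonneg m, mul_nonneg (abs_nonneg m) hk]

/-- The set of the pairs of an angle and a radius for which the cost exceeds a level is open. -/
lemma isOpen_lt_cost (N : DistributionNetwork d) (β : ℝ) (γ μ : Fin d → ℝ)
    (W : Matrix (Fin d) (Fin d) ℝ) (k : ℝ) (n : ℕ) :
    IsOpen {p : EuclideanSpace ℝ (Fin d) × ℝ |
      (k : EReal) < N.cost β γ n (polarDemand μ W p.2 p.1)} := by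
  simp_rw [lt_cost_iff, dotProduct_polarDemand_sub_supply]
  have : {p : EuclideanSpace ℝ (Fin d) × ℝ | ∃ y ∈ N.dualFeasible,
      k < y ⬝ᵥ μ + p.2 * inner ℝ (loading W y) p.1 - (n : ℝ) ^ β * (y ⬝ᵥ γ)} =
      ⋃ y ∈ N.dualFeasible, {p : EuclideanSpace ℝ (Fin d) × ℝ |
        k < y ⬝ᵥ μ + p.2 * inner ℝ (loading W y) p.1 - (n : ℝ) ^ β * (y ⬝ᵥ γ)} := by
    ext p; simp
  rw [this]
  -- The union over `y` is uncountable; openness is what makes the event measurable.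
  exact isOpen_biUnion fun y _ => isOpen_lt continuous_const (by fun_prop)

end DistributionNetwork

end Network

/-! ### Exponential bounds for Gamma tails -/

section GammaTails

/-- Exponential tilting from rate `r` to rate `θ`; for `θ ≤ r` the likelihood ratio is decreasing in
`x`, which gives the Chernoff bound. -/
lemma gammaPDF_eq_mul_gammaPDF {a r θ : ℝ} (hr : 0 < r) (hθ : 0 < θ) (x : ℝ) :
    gammaPDF a r x =
      ENNReal.ofReal ((r / θ) ^ a * Real.exp (-((r - θ) * x))) * gammaPDF a θ x := by
  rcases lt_or_ge x 0 with hx | hx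
  · simp [gammaPDF_of_neg hx]
  rw [gammaPDF_of_nonneg hx, gammaPDF_of_nonneg hx, ← ENNReal.ofReal_mul (by positivity),
    Real.div_rpow hr.le hθ.le]
  have h : Real.exp (-(r * x)) = Real.exp (-((r - θ) * x)) * Real.exp (-(θ * x)) := by
    rw [← Real.exp_add]; ring_nf
  rw [h]
  have := (Real.rpow_pos_of_pos hθ a).ne'
  congr 1
  field_simp

/-- The exponential Chebyshev bound for the tail of the Gamma distribution. -/
lemma gammaMeasure_Ioi_le {a r θ : ℝ} (ha : 0 < a) (hr : 0 < r) (hθ : 0 < θ) (hθr : θ ≤ r)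
    (u : ℝ) :
    (gammaMeasure a r).real (Set.Ioi u) ≤ (r / θ) ^ a * Real.exp (-((r - θ) * u)) := by
  refine ENNReal.toReal_le_of_le_ofReal (by positivity) ?_
  rw [gammaMeasure, withDensity_apply _ measurableSet_Ioi]
  calc ∫⁻ x in Set.Ioi u, gammaPDF a r x
      ≤ ∫⁻ x in Set.Ioi u,
          ENNReal.ofReal ((r / θ) ^ a * Real.exp (-((r - θ) * u))) * gammaPDF a θ x := by
        refine setLIntegral_mono' measurableSet_Ioi fun x hx => ?_
        rw [gammaPDF_eq_mul_gammaPDF hr hθ]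
        gcongr
        exact le_of_lt hx
    _ ≤ ∫⁻ x, ENNReal.ofReal ((r / θ) ^ a * Real.exp (-((r - θ) * u))) * gammaPDF a θ x :=
        setLIntegral_le_lintegral _ _
    _ = _ := by
        rw [lintegral_const_mul' _ _ ENNReal.ofReal_ne_top, lintegral_gammaPDF_eq_one ha hθ,
          mul_one]

/-- Only the mass of `(u, u + 1]` is kept. There `x^(a-1) ≥ x⁻¹ ≥ δ exp(-δx)`, so a slightly larger
rate absorbs the power for every `a > 0`. -/
lemma le_gammaMeasure_Ioi {a r δ : ℝ} (ha : 0 < a) (hr : 0 < r) (hδ : 0 < δ) {u : ℝ}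
    (hu : 1 ≤ u) :
    r ^ a / Real.Gamma a * δ * Real.exp (-((r + δ) * (u + 1))) ≤
      (gammaMeasure a r).real (Set.Ioi u) := by
  have hΓ := Real.Gamma_pos_of_pos ha
  have := isProbabilityMeasure_gammaMeasure ha hr
  refine (ENNReal.ofReal_le_iff_le_toReal (measure_ne_top _ _)).mp ?_
  rw [gammaMeasure, withDensity_apply _ measurableSet_Ioi]
  calc ENNReal.ofReal (r ^ a / Real.Gamma a * δ * Real.exp (-((r + δ) * (u + 1))))
      = ∫⁻ _ in Set.Ioc u (u + 1),
          ENNReal.ofReal (r ^ a / Real.Gamma a * δ * Real.exp (-((r + δ) * (u + 1)))) := by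
        simp
    _ ≤ ∫⁻ x in Set.Ioc u (u + 1), gammaPDF a r x := by
        refine setLIntegral_mono' measurableSet_Ioc fun x hx => ?_
        have hx1 : 1 ≤ x := hu.trans hx.1.le
        have hx0 : 0 < x := by linarith
        rw [gammaPDF_of_nonneg hx0.le]
        refine ENNReal.ofReal_le_ofReal ?_
        have h1 : δ * Real.exp (-(δ * x)) ≤ x ^ (a - 1) := by
          have h2 : δ * x ≤ Real.exp (δ * x) := by linarith [Real.add_one_le_exp (δ * x)]
          calc δ * Real.exp (-(δ * x)) ≤ x⁻¹ := by
                rw [Real.exp_neg, ← div_eq_mul_inv, div_le_iff₀ (Real.exp_pos _),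
                  ← div_eq_inv_mul, le_div_iff₀ hx0]
                exact h2
            _ = x ^ (-1 : ℝ) := (Real.rpow_neg_one x).symm
            _ ≤ x ^ (a - 1) := Real.rpow_le_rpow_of_exponent_le hx1 (by linarith)
        calc r ^ a / Real.Gamma a * δ * Real.exp (-((r + δ) * (u + 1)))
            ≤ r ^ a / Real.Gamma a * δ * Real.exp (-((r + δ) * x)) := by
              gcongr
              exact hx.2
          _ = r ^ a / Real.Gamma a * (δ * Real.exp (-(δ * x))) * Real.exp (-(r * x)) := by
              have : Real.exp (-((r + δ) * x)) = Real.exp (-(δ * x)) * Real.exp (-(r * x)) := by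
                rw [← Real.exp_add]; ring_nf
              rw [this]; ring
          _ ≤ _ := by gcongr
    _ ≤ ∫⁻ x in Set.Ioi u, gammaPDF a r x := lintegral_mono_set Set.Ioc_subset_Ioi_self

end GammaTails

/-! ### Gaussian probability of a spherical cap -/

section Cap

lemma le_gaussianReal_Icc {a b m : ℝ} (ha : -m ≤ a) (hb : b ≤ m) :
    gaussianPDFReal 0 1 m * (b - a) ≤ (gaussianReal 0 1).real (Set.Icc a b) := by
  refine (ENNReal.ofReal_le_iff_le_toReal (measure_ne_top _ _)).mp ?_
  rw [gaussianReal_apply _ one_ne_zero]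
  calc ENNReal.ofReal (gaussianPDFReal 0 1 m * (b - a))
      = ∫⁻ _ in Set.Icc a b, ENNReal.ofReal (gaussianPDFReal 0 1 m) := by
        simp [ENNReal.ofReal_mul (gaussianPDFReal_nonneg 0 1 m)]
    _ ≤ _ := by
        refine setLIntegral_mono' measurableSet_Icc fun x hx => ENNReal.ofReal_le_ofReal ?_
        have hsq : x ^ 2 ≤ m ^ 2 := sq_le_sq' (ha.trans hx.1) (hx.2.trans hb)
        simp only [gaussianPDFReal, sub_zero]
        gcongr

/-- Here `‖z‖² ≤ x₀² + d t² ≤ (1 + d t²) x₀²` because `x₀ ≥ 1`. The square root of the factor is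
then bounded by the factor itself. -/
lemma le_inner_angle {d : ℕ} (b : OrthonormalBasis (Fin d) ℝ (EuclideanSpace ℝ (Fin d)))
    (i₀ : Fin d) {t : ℝ} {x : Fin d → ℝ} (hx₀ : 1 ≤ x i₀) (hx : ∀ i ≠ i₀, |x i| ≤ t) :
    1 ≤ (1 + d * t ^ 2) * inner ℝ (b i₀) (angle (∑ i, x i • b i)) := by
  set z := ∑ i, x i • b i with hz
  have hinner : inner ℝ (b i₀) z = x i₀ := b.orthonormal.inner_right_fintype x i₀
  have hnorm : ‖z‖ ^ 2 = ∑ i, x i ^ 2 := by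
    rw [← b.sum_sq_norm_inner_right]
    refine Finset.sum_congr rfl fun i _ => ?_
    rw [hz, b.orthonormal.inner_right_fintype x i, Real.norm_eq_abs, sq_abs]
  have hle : ‖z‖ ^ 2 ≤ x i₀ ^ 2 + d * t ^ 2 := by
    rw [hnorm, ← Finset.add_sum_erase _ _ (Finset.mem_univ i₀)]
    gcongr
    calc ∑ i ∈ Finset.univ.erase i₀, x i ^ 2 ≤ ∑ i ∈ Finset.univ.erase i₀, t ^ 2 := by
          refine Finset.sum_le_sum fun i hi => ?_
          rw [← sq_abs]
          have := hx i (Finset.ne_of_mem_erase hi)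
          gcongr
      _ ≤ ∑ _i : Fin d, t ^ 2 :=
          Finset.sum_le_sum_of_subset_of_nonneg (Finset.erase_subset _ _)
            fun _ _ _ => sq_nonneg t
      _ = d * t ^ 2 := by simp
  have hz0 : 0 < ‖z‖ := by
    refine (norm_nonneg z).lt_of_ne' fun h => ?_
    rw [norm_eq_zero.mp h, inner_zero_right] at hinner
    linarith
  have hzle : ‖z‖ ≤ (1 + d * t ^ 2) * x i₀ := by
    have hτ : 0 ≤ d * t ^ 2 := by positivity
    refine le_of_sq_le_sq ?_ (by positivity)
    nlinarith [mul_nonneg hτ (sub_nonneg.mpr (one_le_pow₀ hx₀ : 1 ≤ x i₀ ^ 2)),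
      mul_nonneg (mul_nonneg hτ hτ) (sq_nonneg (x i₀))]
  rw [angle, real_inner_smul_right, hinner, ← mul_assoc, mul_comm _ ‖z‖⁻¹, mul_assoc,
    ← div_eq_inv_mul, le_div_iff₀ hz0, one_mul]
  exact hzle

/-- The angle of a standard Gaussian vector falls into a spherical cap of radius of order `t` with
probability at least of order `t ^ (d - 1)`. -/
lemma exists_le_stdGaussian_cap {d : ℕ} (hd : 0 < d) {u : EuclideanSpace ℝ (Fin d)}
    (hu : ‖u‖ = 1) :
    ∃ c : ℝ, 0 < c ∧ ∀ t : ℝ, 0 ≤ t → t ≤ 1 →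
      c * t ^ (d - 1) ≤ (stdGaussian (EuclideanSpace ℝ (Fin d))).real
        {z | 1 ≤ (1 + d * t ^ 2) * inner ℝ u (angle z)} := by
  set i₀ : Fin d := ⟨0, hd⟩
  obtain ⟨b, hb⟩ := Orthonormal.exists_orthonormalBasis_extension_of_card_eq
    (𝕜 := ℝ) (E := EuclideanSpace ℝ (Fin d)) (ι := Fin d) (by simp) (v := fun _ => u)
    (s := {i₀}) (by
      constructor
      · simp [hu]
      · intro i j hij
        exact absurd (Subsingleton.elim i j) hij)
  have hbu : b i₀ = u := hb i₀ rfl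
  set c₀ := gaussianPDFReal 0 1 2
  have hc₀ : 0 < c₀ := gaussianPDFReal_pos 0 1 2 one_ne_zero
  refine ⟨c₀ ^ d, by positivity, fun t ht0 ht1 => ?_⟩
  -- In an orthonormal basis starting with `u` the coordinates are independent. This box lies in the
  -- cone over the cap, and its `d - 1` short sides give `t ^ (d - 1)`. All sides lie in `[-2, 2]`,
  -- where the density is at least `c₀`.
  set B : Fin d → Set ℝ := fun i => if i = i₀ then Set.Icc 1 2 else Set.Icc (-t) t with hB
  rw [stdGaussian_eq_map_pi_orthonormalBasis b, map_measureReal_apply (by fun_prop)]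
  · calc c₀ ^ d * t ^ (d - 1) = ∏ i, c₀ * (if i = i₀ then 1 else t) := by
          rw [Finset.prod_mul_distrib, Finset.prod_const, Finset.card_univ, Fintype.card_fin,
            ← Finset.mul_prod_erase _ _ (Finset.mem_univ i₀), if_pos rfl, one_mul,
            Finset.prod_congr rfl fun i hi => if_neg (Finset.ne_of_mem_erase hi)]
          simp
      _ ≤ ∏ i, (gaussianReal 0 1).real (B i) := by
          refine Finset.prod_le_prod (fun i _ => by split_ifs <;> positivity) fun i _ => ?_
          simp only [hB]
          split_ifs with h
          · calc c₀ * 1 = c₀ * (2 - 1) := by norm_num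
              _ ≤ _ := le_gaussianReal_Icc (by norm_num) le_rfl
          · calc c₀ * t ≤ c₀ * (t - -t) := by gcongr; linarith
              _ ≤ _ := le_gaussianReal_Icc (by linarith) (by linarith)
      _ = (Measure.pi fun _ : Fin d => gaussianReal 0 1).real (Set.univ.pi B) := by
          simp [Measure.real, Measure.pi_pi, ENNReal.toReal_prod]
      _ ≤ _ := by
          refine measureReal_mono fun x hx => ?_
          simp only [Set.mem_pi, Set.mem_univ, true_implies, hB] at hx
          simp only [Set.mem_preimage, Set.mem_ofPred_eq, ← hbu]
          refine le_inner_angle b i₀ ?_ fun i hi => ?_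
          · have := hx i₀
            rw [if_pos rfl] at this
            exact this.1
          · have := hx i
            rw [if_neg hi] at this
            exact abs_le.mpr this
  · unfold angle
    exact measurableSet_le measurable_const (by fun_prop)

end Cap

/-! ### Conditional probability by freezing an independent variable -/

section Conditioning

/-- For independent `X` and `Y` the conditional probability of `(X, Y) ∈ S` given `X` is obtained
by freezing `X`. -/
lemma measureReal_section_ae_eq_condExp {Ω 𝓧 𝓨 : Type*} [MeasurableSpace Ω] [MeasurableSpace 𝓧]
    [MeasurableSpace 𝓨] [StandardBorelSpace 𝓨] [Nonempty 𝓨] {P : Measure Ω} [IsFiniteMeasure P]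
    {X : Ω → 𝓧} {Y : Ω → 𝓨} (hX : Measurable X) (hY : Measurable Y) (hXY : IndepFun X Y P)
    {S : Set (𝓧 × 𝓨)} (hS : MeasurableSet S) :
    (fun ω => P.real {ω' | (X ω, Y ω') ∈ S}) =ᵐ[P]
      P[{ω | (X ω, Y ω) ∈ S}.indicator (fun _ => (1 : ℝ)) |
        MeasurableSpace.comap X inferInstance] := by
  rcases isEmpty_or_nonempty Ω with hΩ | hΩ
  · exact Eventually.of_forall fun ω => hΩ.elim ω
  rcases eq_or_ne P 0 with rfl | hP
  · simp [Filter.EventuallyEq]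
  -- By independence the joint law is a product, so the conditional law of `Y` is a constant kernel.
  have hcd : condDistrib Y X P =ᵐ[P.map X] Kernel.const 𝓧 (P.map Y) := by
    refine condDistrib_ae_eq_of_measure_eq_compProd X hY.aemeasurable ?_
    rw [Measure.compProd_const]
    exact (indepFun_iff_map_prod_eq_prod_map_map hX.aemeasurable hY.aemeasurable).mp hXY
  have hce := condExp_prod_ae_eq_integral_condDistrib (μ := P) hX hY.aemeasurable
    (f := S.indicator fun _ => (1 : ℝ)) (stronglyMeasurable_const.indicator hS)
    (by
      refine (integrable_const (1 : ℝ)).indicator (s := {ω | (X ω, Y ω) ∈ S}) ?_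
      exact (hX.prodMk hY) hS)
  have hcd' := ae_of_ae_map hX.aemeasurable hcd
  filter_upwards [hce, hcd'] with ω h1 h2
  have h3 : (fun ω => S.indicator (fun _ => (1 : ℝ)) (X ω, Y ω)) =
      {ω | (X ω, Y ω) ∈ S}.indicator fun _ => (1 : ℝ) := rfl
  rw [← h3, h1, h2, Kernel.const_apply]
  have h4 : (fun y => S.indicator (fun _ => (1 : ℝ)) (X ω, y)) =
      (Prod.mk (X ω) ⁻¹' S).indicator fun _ => (1 : ℝ) := rfl
  have h5 : MeasurableSet (Prod.mk (X ω) ⁻¹' S) := measurable_prodMk_left hS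
  rw [h4, integral_indicator_const _ h5, map_measureReal_apply hY h5]
  simp
  rfl

end Conditioning

/-! ### Tails of the radius and their comparison -/

section Radius

variable {d : ℕ} {Ω : Type*} [MeasurableSpace Ω] {P : Measure Ω}
  {R : Ω → ℝ} {z : Ω → EuclideanSpace ℝ (Fin d)}

lemma measurable_angle : Measurable (angle (d := d)) := by
  unfold angle
  fun_prop

lemma antitone_measureReal_lt [IsFiniteMeasure P] (R : Ω → ℝ) :
    Antitone fun x => P.real {ω | x < R ω} :=
  fun _ _ hxy => measureReal_mono fun _ hω => hxy.trans_lt hω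

namespace IsPolarPair

lemma measureReal_lt_radius (h : IsPolarPair P R z) {x : ℝ} (hx : 0 ≤ x) :
    P.real {ω | x < R ω} = (gammaMeasure ((d : ℝ) / 2) (1 / 2)).real (Set.Ioi (x ^ 2)) := by
  rw [← h.radius_law.map_eq, map_measureReal_apply (h.measurable_radius.pow_const 2)
    measurableSet_Ioi]
  refine measureReal_congr ?_
  filter_upwards [h.radius_nonneg] with ω hω
  refine propext ?_
  change x < R ω ↔ x ^ 2 < R ω ^ 2
  exact (pow_lt_pow_iff_left₀ hx hω two_ne_zero).symm

lemma exists_radius_tail_le (h : IsPolarPair P R z) (hd : 0 < d) {δ : ℝ} (hδ : 0 < δ)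
    (hδ1 : δ < 1) :
    ∃ C : ℝ, 0 < C ∧ ∀ x, 0 ≤ x →
      P.real {ω | x < R ω} ≤ C * Real.exp (-((1 - δ) * x ^ 2 / 2)) := by
  have ha : 0 < (d : ℝ) / 2 := by positivity
  refine ⟨(1 / 2 / (δ / 2)) ^ ((d : ℝ) / 2), by positivity, fun x hx => ?_⟩
  rw [h.measureReal_lt_radius hx]
  refine (gammaMeasure_Ioi_le ha one_half_pos (half_pos hδ) (by linarith) _).trans_eq ?_
  ring_nf

lemma exists_le_radius_tail (h : IsPolarPair P R z) (hd : 0 < d) {δ : ℝ} (hδ : 0 < δ) :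
    ∃ c : ℝ, 0 < c ∧ ∀ x, 1 ≤ x →
      c * Real.exp (-((1 + δ) * x ^ 2 / 2)) ≤ P.real {ω | x < R ω} := by
  have ha : 0 < (d : ℝ) / 2 := by positivity
  have hΓ := Real.Gamma_pos_of_pos ha
  -- The last factor absorbs the `+ 1` of the endpoint `u + 1`, with `u = x ^ 2`.
  refine ⟨(1 / 2) ^ ((d : ℝ) / 2) / Real.Gamma (d / 2) * (δ / 2) *
    Real.exp (-((1 + δ) / 2)), by positivity, fun x hx => ?_⟩
  rw [h.measureReal_lt_radius (by linarith)]
  refine le_trans (le_of_eq ?_) (le_gammaMeasure_Ioi ha one_half_pos (half_pos hδ)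
    (one_le_pow₀ hx))
  rw [mul_assoc, ← Real.exp_add]
  ring_nf

lemma measureReal_lt_radius_pos [IsProbabilityMeasure P] (h : IsPolarPair P R z) (hd : 0 < d)
    (x : ℝ) : 0 < P.real {ω | x < R ω} := by
  obtain ⟨c, hc, hle⟩ := h.exists_le_radius_tail hd one_pos
  have h1 := hle (max x 1) (le_max_right _ _)
  have h2 := antitone_measureReal_lt (P := P) R (le_max_left x 1)
  have h3 : 0 < c * Real.exp (-((1 + 1) * max x 1 ^ 2 / 2)) := by positivity
  exact h3.trans_le (h1.trans h2)

lemma exists_le_angle_cap (h : IsPolarPair P R z) (hd : 0 < d) {u : EuclideanSpace ℝ (Fin d)}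
    (hu : ‖u‖ = 1) :
    ∃ c : ℝ, 0 < c ∧ ∀ t : ℝ, 0 ≤ t → t ≤ 1 →
      c * t ^ (d - 1) ≤ P.real {ω | 1 ≤ (1 + d * t ^ 2) * inner ℝ u (angle (z ω))} := by
  obtain ⟨c, hc, hle⟩ := exists_le_stdGaussian_cap hd hu
  refine ⟨c, hc, fun t ht0 ht1 => (hle t ht0 ht1).trans_eq ?_⟩
  have hm := measurable_angle (d := d)
  rw [← h.gauss_law.map_eq, map_measureReal_apply h.measurable_gauss]
  · rfl
  · exact measurableSet_le measurable_const (by fun_prop)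

/-- The tail of the radius at `x - C`, squared, is dominated by the power `2 - ε` of the tail at
`x + o(x)` times a polynomial factor, for `x = n ^ β * s`. -/
lemma exists_tail_sq_le_rpow [IsProbabilityMeasure P] (h : IsPolarPair P R z) (hd : 0 < d)
    {β s c C K : ℝ} (hβ : 0 < β) (hs : 0 < s) (hc : 0 < c) {k : ℕ → ℝ}
    (hk : k =o[atTop] fun n : ℕ => (n : ℝ) ^ β) {ε : ℝ} (hε : 0 < ε) (hε2 : ε < 2) :
    ∃ B : ℝ, ∀ᶠ n : ℕ in atTop,
      P.real {ω | (n : ℝ) ^ β * s - C < R ω} ^ 2 ≤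
        B * (c * P.real {ω | (n : ℝ) ^ β * s + K * (1 + k n) < R ω} *
          (n : ℝ) ^ (-(((d : ℝ) - 1) * β))) ^ (2 - ε) := by
  -- Shifting the radius by `δx` costs `3δ` above and `7δ` below in the exponent, and the polynomial
  -- factor costs another `δ`. The final comparison needs `11δ ≤ ε / 2 + 4δε`.
  set δ := ε / 22 with hδ_def
  have hδ : 0 < δ := by positivity
  have hδ1 : δ < 1 := by linarith
  obtain ⟨C₁, hC₁, hupper⟩ := h.exists_radius_tail_le hd hδ hδ1
  obtain ⟨c₁, hc₁, hlower⟩ := h.exists_le_radius_tail hd hδ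
  have hv : Tendsto (fun n : ℕ => (n : ℝ) ^ β) atTop atTop :=
    (tendsto_rpow_atTop hβ).comp tendsto_natCast_atTop_atTop
  have hKk : (fun n => K * (1 + k n)) =o[atTop] fun n : ℕ => (n : ℝ) ^ β := by
    refine (IsLittleO.add ?_ hk).const_mul_left K
    refine isLittleO_const_left.mpr (Or.inr ?_)
    exact tendsto_norm_atTop_atTop.comp hv
  have hpoly : ∀ᶠ v : ℝ in atTop, v ^ (d - 1) ≤ Real.exp (δ * (v * s) ^ 2 / 2) := by
    filter_upwards [(Real.isLittleO_pow_exp_atTop (n := d - 1)).bound one_pos,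
      eventually_ge_atTop (2 / (δ * s ^ 2)), eventually_ge_atTop 0] with v h1 h2 h3
    rw [one_mul, Real.norm_of_nonneg (by positivity), Real.norm_of_nonneg (by positivity)] at h1
    refine h1.trans (Real.exp_le_exp.mpr ?_)
    rw [div_le_iff₀ (by positivity)] at h2
    nlinarith
  refine ⟨C₁ ^ 2 / (c * c₁) ^ (2 - ε), ?_⟩
  filter_upwards [hKk.bound (mul_pos hδ hs), hv.eventually_ge_atTop (C / (δ * s)),
    hv.eventually_ge_atTop (1 / s), hv.eventually hpoly, eventually_gt_atTop 0]
    with n hn1 hn2 hn3 hn4 hn0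
  have hn0' : (0 : ℝ) < n := by exact_mod_cast hn0
  have hpow : (n : ℝ) ^ (-(((d : ℝ) - 1) * β)) = (((n : ℝ) ^ β) ^ (d - 1))⁻¹ := by
    rw [Real.rpow_neg hn0'.le, mul_comm, Real.rpow_mul hn0'.le, ← Real.rpow_natCast,
      Nat.cast_pred hd]
  rw [hpow]
  have hv0 : 0 < (n : ℝ) ^ β := by positivity
  set v := (n : ℝ) ^ β
  set x := v * s with hx
  have hx1 : 1 ≤ x := (div_le_iff₀ hs).mp hn3
  have hx0 : 0 ≤ x := by linarith
  rw [Real.norm_of_nonneg hv0.le] at hn1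
  have hK : K * (1 + k n) ≤ δ * x := by
    refine (le_abs_self _).trans (hn1.trans_eq ?_)
    rw [hx]; ring
  have hC : C ≤ δ * x := by
    rw [div_le_iff₀ (by positivity)] at hn2
    rw [hx]; linarith
  have h1 : P.real {ω | x - C < R ω} ≤ C₁ * Real.exp (-((1 - 3 * δ) * x ^ 2 / 2)) := by
    calc P.real {ω | x - C < R ω} ≤ P.real {ω | (1 - δ) * x < R ω} :=
          antitone_measureReal_lt R (by linarith)
      _ ≤ C₁ * Real.exp (-((1 - δ) * ((1 - δ) * x) ^ 2 / 2)) :=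
          hupper _ (mul_nonneg (by linarith) hx0)
      _ ≤ _ := by
          gcongr C₁ * Real.exp (-(?_ / 2))
          have : (1 - 3 * δ) * x ^ 2 ≤ (1 - δ) ^ 3 * x ^ 2 := by
            gcongr
            nlinarith [sq_nonneg δ]
          linarith
  have h2 : c₁ * Real.exp (-((1 + 7 * δ) * x ^ 2 / 2)) ≤
      P.real {ω | x + K * (1 + k n) < R ω} := by
    calc c₁ * Real.exp (-((1 + 7 * δ) * x ^ 2 / 2))
        ≤ c₁ * Real.exp (-((1 + δ) * ((1 + δ) * x) ^ 2 / 2)) := by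
          gcongr c₁ * Real.exp (-(?_ / 2))
          have : (1 + δ) ^ 3 * x ^ 2 ≤ (1 + 7 * δ) * x ^ 2 := by
            gcongr
            nlinarith [mul_pos hδ hδ, mul_pos hδ (sub_pos.mpr hδ1),
              mul_pos (mul_pos hδ hδ) (sub_pos.mpr hδ1)]
          linarith
      _ ≤ P.real {ω | (1 + δ) * x < R ω} := hlower _ (by nlinarith)
      _ ≤ _ := antitone_measureReal_lt R (by linarith)
  have h3 : Real.exp (-(δ * x ^ 2 / 2)) ≤ (v ^ (d - 1))⁻¹ := by
    rw [Real.exp_neg]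
    gcongr
  have h4 : c * c₁ * Real.exp (-((1 + 8 * δ) * x ^ 2 / 2)) ≤
      c * P.real {ω | x + K * (1 + k n) < R ω} * (v ^ (d - 1))⁻¹ := by
    calc c * c₁ * Real.exp (-((1 + 8 * δ) * x ^ 2 / 2))
        = c * (c₁ * Real.exp (-((1 + 7 * δ) * x ^ 2 / 2))) * Real.exp (-(δ * x ^ 2 / 2)) := by
          rw [mul_assoc c, mul_assoc c, mul_assoc c₁, ← Real.exp_add]
          ring_nf
      _ ≤ _ := by gcongr
  have h2ε : 0 ≤ 2 - ε := by linarith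
  calc P.real {ω | x - C < R ω} ^ 2
      ≤ (C₁ * Real.exp (-((1 - 3 * δ) * x ^ 2 / 2))) ^ 2 := by gcongr
    _ = C₁ ^ 2 * Real.exp (-((1 - 3 * δ) * x ^ 2)) := by
        rw [mul_pow, ← Real.exp_nat_mul]
        push_cast
        ring_nf
    _ ≤ C₁ ^ 2 * Real.exp (-((1 + 8 * δ) * x ^ 2 / 2) * (2 - ε)) := by
        gcongr
        have : 0 ≤ ((1 - 3 * δ) - (1 + 8 * δ) * (2 - ε) / 2) * x ^ 2 := by
          refine mul_nonneg ?_ (sq_nonneg x)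
          rw [hδ_def]
          nlinarith
        linarith
    _ = C₁ ^ 2 / (c * c₁) ^ (2 - ε) *
          (c * c₁ * Real.exp (-((1 + 8 * δ) * x ^ 2 / 2))) ^ (2 - ε) := by
        rw [Real.mul_rpow (x := c * c₁) (by positivity) (by positivity), ← Real.exp_mul]
        have : (c * c₁) ^ (2 - ε) ≠ 0 := (Real.rpow_pos_of_pos (by positivity) _).ne'
        field_simp
    _ ≤ _ := by gcongr

end IsPolarPair

end Radius

/-! ### The estimator and the failure probability -/

section Main

variable {d : ℕ} {Ω : Type*} [MeasurableSpace Ω] {P : Measure Ω}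
  {R : Ω → ℝ} {z : Ω → EuclideanSpace ℝ (Fin d)}

lemma condFailureProb_ae_eq_condExp [IsProbabilityMeasure P] (N : DistributionNetwork d)
    (hpolar : IsPolarPair P R z) (β : ℝ) (γ μ : Fin d → ℝ) (W : Matrix (Fin d) (Fin d) ℝ)
    (k : ℕ → ℝ) (n : ℕ) :
    (fun ω => condFailureProb N β γ μ W k P R n (angle (z ω))) =ᵐ[P]
      P[(failureEvent N β γ μ W k R z n).indicator (fun _ => (1 : ℝ)) |
        MeasurableSpace.comap (fun ω => angle (z ω)) inferInstance] :=
  measureReal_section_ae_eq_condExp (measurable_angle.comp hpolar.measurable_gauss)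
    hpolar.measurable_radius hpolar.indep.symm
    (N.isOpen_lt_cost β γ μ W (k n) n).measurableSet

lemma measurableSet_failureEvent (N : DistributionNetwork d)
    (hpolar : IsPolarPair P R z) (β : ℝ) (γ μ : Fin d → ℝ) (W : Matrix (Fin d) (Fin d) ℝ)
    (k : ℕ → ℝ) (n : ℕ) : MeasurableSet (failureEvent N β γ μ W k R z n) :=
  ((measurable_angle.comp hpolar.measurable_gauss).prodMk hpolar.measurable_radius)
    (N.isOpen_lt_cost β γ μ W (k n) n).measurableSet

lemma condFailureProb_nonneg (N : DistributionNetwork d) (β : ℝ) (γ μ : Fin d → ℝ)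
    (W : Matrix (Fin d) (Fin d) ℝ) (k : ℕ → ℝ) (n : ℕ) (ψ : EuclideanSpace ℝ (Fin d)) :
    0 ≤ condFailureProb N β γ μ W k P R n ψ :=
  measureReal_nonneg

lemma condFailureProb_le_one [IsProbabilityMeasure P] (N : DistributionNetwork d) (β : ℝ)
    (γ μ : Fin d → ℝ) (W : Matrix (Fin d) (Fin d) ℝ) (k : ℕ → ℝ) (n : ℕ)
    (ψ : EuclideanSpace ℝ (Fin d)) :
    condFailureProb N β γ μ W k P R n ψ ≤ 1 :=
  measureReal_le_one

lemma memLp_condFailureProb [IsProbabilityMeasure P] (N : DistributionNetwork d)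
    (hpolar : IsPolarPair P R z) (β : ℝ) (γ μ : Fin d → ℝ) (W : Matrix (Fin d) (Fin d) ℝ)
    (k : ℕ → ℝ) (n : ℕ) :
    MemLp (fun ω => condFailureProb N β γ μ W k P R n (angle (z ω))) 2 P := by
  refine MemLp.of_bound (integrable_condExp.congr
    (condFailureProb_ae_eq_condExp N hpolar β γ μ W k n).symm).aestronglyMeasurable 1
    (Eventually.of_forall fun ω => ?_)
  rw [Real.norm_of_nonneg (condFailureProb_nonneg ..)]
  exact condFailureProb_le_one ..

lemma integral_condFailureProb [IsProbabilityMeasure P] (N : DistributionNetwork d)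
    (hpolar : IsPolarPair P R z) (β : ℝ) (γ μ : Fin d → ℝ) (W : Matrix (Fin d) (Fin d) ℝ)
    (k : ℕ → ℝ) (n : ℕ) :
    ∫ ω, condFailureProb N β γ μ W k P R n (angle (z ω)) ∂P =
      P.real (failureEvent N β γ μ W k R z n) := by
  have hm : MeasurableSpace.comap (fun ω => angle (z ω)) inferInstance ≤ ‹MeasurableSpace Ω› :=
    (measurable_angle.comp hpolar.measurable_gauss).comap_le
  rw [integral_congr_ae (condFailureProb_ae_eq_condExp N hpolar β γ μ W k n), integral_condExp hm,
    integral_indicator_const _ (measurableSet_failureEvent N hpolar β γ μ W k n), smul_eq_mul,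
    mul_one]

lemma integral_sq_condFailureProb_le [IsProbabilityMeasure P] (N : DistributionNetwork d)
    (hpolar : IsPolarPair P R z) (β : ℝ) (γ μ : Fin d → ℝ) (W : Matrix (Fin d) (Fin d) ℝ)
    (k : ℕ → ℝ) (n : ℕ) {q : ℝ}
    (hq : ∀ ψ : EuclideanSpace ℝ (Fin d), ‖ψ‖ ≤ 1 → condFailureProb N β γ μ W k P R n ψ ≤ q) :
    ∫ ω, condFailureProb N β γ μ W k P R n (angle (z ω)) ^ 2 ∂P ≤ q ^ 2 := by
  calc ∫ ω, condFailureProb N β γ μ W k P R n (angle (z ω)) ^ 2 ∂P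
      ≤ ∫ _, q ^ 2 ∂P := by
        refine integral_mono (memLp_condFailureProb N hpolar β γ μ W k n).integrable_sq
          (integrable_const _) fun ω => ?_
        -- The angle of `0` is `0`, so working with the unit ball instead of the sphere makes the
        -- bound hold at every `ω`.
        have h1 : ‖angle (z ω)‖ ≤ 1 := by
          rw [angle, norm_smul, norm_inv, norm_norm]
          exact inv_mul_le_one
        exact pow_le_pow_left₀ (condFailureProb_nonneg ..) (hq _ h1) 2
    _ = q ^ 2 := by simp

/-- The two-sided comparison of the failure probabilities with the tail of the radius. -/
lemma exists_failure_bounds [IsProbabilityMeasure P] (hd : 0 < d) (N : DistributionNetwork d)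
    (hpolar : IsPolarPair P R z) {β : ℝ} (hβ : 0 < β) {γ : Fin d → ℝ} (hγ : ∀ i, 0 < γ i)
    (μ : Fin d → ℝ) {W : Matrix (Fin d) (Fin d) ℝ} (hW : IsUnit W) {k : ℕ → ℝ}
    (hk : ∀ n, 0 ≤ k n) :
    ∃ s C K c : ℝ, 0 < s ∧ 0 < c ∧
      (∀ (n : ℕ) (ψ : EuclideanSpace ℝ (Fin d)), ‖ψ‖ ≤ 1 →
        condFailureProb N β γ μ W k P R n ψ ≤ P.real {ω | (n : ℝ) ^ β * s - C < R ω}) ∧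
      (∀ n : ℕ, 0 < n → c * P.real {ω | (n : ℝ) ^ β * s + K * (1 + k n) < R ω} *
        (n : ℝ) ^ (-(((d : ℝ) - 1) * β)) ≤ P.real (failureEvent N β γ μ W k R z n)) ∧
      ∀ n, 0 < P.real (failureEvent N β γ μ W k R z n) := by
  obtain ⟨y, hy, s, hs, hl, hys, hmin⟩ := N.exists_critical hd hγ hW
  set u := ‖loading W y‖⁻¹ • loading W y
  have hu : ‖u‖ = 1 := norm_smul_inv_norm hl
  obtain ⟨c, hc, hcap⟩ := hpolar.exists_le_angle_cap hd hu
  set M := (1 + |y ⬝ᵥ μ|) / ‖loading W y‖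
  have hM0 : 0 ≤ M := by positivity
  have hmain : ∀ (n : ℕ) (t : ℝ), 0 ≤ t → t ≤ 1 →
      P.real {ω | (1 + d * t ^ 2) * ((n : ℝ) ^ β * s + M * (1 + k n)) < R ω} * (c * t ^ (d - 1)) ≤
        P.real (failureEvent N β γ μ W k R z n) := by
    intro n t ht0 ht1
    have hS : MeasurableSet {ψ : EuclideanSpace ℝ (Fin d) | 1 ≤ (1 + d * t ^ 2) * inner ℝ u ψ} :=
      measurableSet_le measurable_const (by fun_prop)
    calc _ ≤ P.real {ω | (1 + d * t ^ 2) * ((n : ℝ) ^ β * s + M * (1 + k n)) < R ω} *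
          P.real {ω | 1 ≤ (1 + d * t ^ 2) * inner ℝ u (angle (z ω))} := by
          gcongr
          exact hcap t ht0 ht1
      _ = P.real ({ω | (1 + d * t ^ 2) * ((n : ℝ) ^ β * s + M * (1 + k n)) < R ω} ∩
          {ω | 1 ≤ (1 + d * t ^ 2) * inner ℝ u (angle (z ω))}) := by
          have := hpolar.indep.measure_inter_preimage_eq_mul
            (Set.Ioi ((1 + d * t ^ 2) * ((n : ℝ) ^ β * s + M * (1 + k n)))) _ measurableSet_Ioi hS
          rw [Measure.real, Measure.real, ← ENNReal.toReal_mul]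
          exact congrArg ENNReal.toReal this.symm
      _ ≤ _ := by
          refine ENNReal.toReal_mono (measure_ne_top _ _) (measure_mono_ae ?_)
          filter_upwards [hpolar.radius_nonneg] with ω hω h
          exact N.lt_cost_of_lt_radius hy hl hys (hk n) hω (by positivity) h.2 h.1
  refine ⟨s, ‖WithLp.toLp 2 (W⁻¹ *ᵥ μ)‖, d * s + (1 + d) * M, c, hs, hc, fun n ψ hψ => ?_,
    fun n hn => ?_, fun n => ?_⟩
  · refine ENNReal.toReal_mono (measure_ne_top _ _) (measure_mono_ae ?_)
    filter_upwards [hpolar.radius_nonneg] with ω hω h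
    exact N.lt_radius_of_lt_cost μ hW hmin (hk n) hω hψ h
  · have hn1 : (1 : ℝ) ≤ n := by exact_mod_cast hn
    have hn0 : (0 : ℝ) < n := by linarith
    set v := (n : ℝ) ^ β
    have hv1 : 1 ≤ v := Real.one_le_rpow hn1 hβ.le
    have hv0 : 0 < v := by linarith
    have hpow : (n : ℝ) ^ (-(((d : ℝ) - 1) * β)) = (v⁻¹) ^ (d - 1) := by
      rw [Real.rpow_neg hn0.le, mul_comm, Real.rpow_mul hn0.le, inv_pow, ← Real.rpow_natCast,
        Nat.cast_pred hd]
    have hinv1 : v⁻¹ ≤ 1 := inv_le_one_of_one_le₀ hv1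
    -- With `t = v⁻¹` the inflation of the main term `v * s` is `d * s / v`, which stays bounded.
    refine le_trans ?_ (hmain n v⁻¹ (by positivity) hinv1)
    rw [hpow, mul_comm c, mul_assoc]
    gcongr ?_ * _
    refine antitone_measureReal_lt R ?_
    have hkn := hk n
    have e1 : v⁻¹ ^ 2 * (v * s) = v⁻¹ * s := by field_simp
    have e2 : d * (v⁻¹ * s) ≤ d * s * (1 + k n) := by
      calc d * (v⁻¹ * s) ≤ d * (1 * s) := by gcongr
        _ = d * s * 1 := by ring
        _ ≤ d * s * (1 + k n) := by gcongr; linarith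
    have e3 : (d : ℝ) * v⁻¹ ^ 2 * (M * (1 + k n)) ≤ d * 1 ^ 2 * (M * (1 + k n)) := by gcongr
    calc (1 + d * v⁻¹ ^ 2) * (v * s + M * (1 + k n))
        = v * s + d * (v⁻¹ ^ 2 * (v * s)) + M * (1 + k n) + d * v⁻¹ ^ 2 * (M * (1 + k n)) := by
          ring
      _ ≤ v * s + d * s * (1 + k n) + M * (1 + k n) + d * 1 ^ 2 * (M * (1 + k n)) := by
          rw [e1]; gcongr
      _ = _ := by ring
  -- Positivity needs no small cap; `t = 1` also covers `n = 0`.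
  · refine lt_of_lt_of_le ?_ (hmain n 1 zero_le_one le_rfl)
    exact mul_pos (hpolar.measureReal_lt_radius_pos hd _) (by positivity)

lemma exists_forall_le_of_eventually {f : ℕ → ℝ} {B : ℝ} (h : ∀ᶠ n in atTop, f n ≤ B) :
    ∃ C, ∀ n, f n ≤ C := by
  obtain ⟨C, hC⟩ := (isBoundedUnder_of_eventually_le h).bddAbove_range
  exact ⟨C, fun n => hC ⟨n, rfl⟩⟩

end Main

theorem theorem6 {d : ℕ} (hd : 0 < d) (N : DistributionNetwork d)
    (β : ℝ) (hβ : 0 < β) (γ : Fin d → ℝ) (hγ : ∀ i, 0 < γ i)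
    (μ : Fin d → ℝ) (Cov W : Matrix (Fin d) (Fin d) ℝ) (hCov : Cov.PosDef) (hW : W * Wᵀ = Cov)
    {Ω : Type*} [MeasurableSpace Ω] (P : Measure Ω) [IsProbabilityMeasure P]
    (R : Ω → ℝ) (z : Ω → EuclideanSpace ℝ (Fin d)) (hpolar : IsPolarPair P R z)
    (k : ℕ → ℝ) (hk_nonneg : ∀ n, 0 ≤ k n)
    (hk : k =o[atTop] fun n : ℕ => (n : ℝ) ^ β) :
    -- `T_n(Ψ)` is the conditional probability of `{L_n(D) > k_n}` given `Ψ`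
    (∀ n, (fun ω => condFailureProb N β γ μ W k P R n (angle (z ω))) =ᵐ[P]
      P[(failureEvent N β γ μ W k R z n).indicator (fun _ => (1 : ℝ)) |
        MeasurableSpace.comap (fun ω => angle (z ω)) inferInstance]) ∧
    -- the two bounds, with `η₁ = O(n ^ β)` and `η₂ = O(1)`
    (∃ (n₀ : ℕ) (c₃ s : ℝ) (η₁ η₂ : ℕ → ℝ), 0 < n₀ ∧ 0 < c₃ ∧ 0 < s ∧
      (η₁ =O[atTop] fun n : ℕ => (n : ℝ) ^ β) ∧ (η₂ =O[atTop] fun _ : ℕ => (1 : ℝ)) ∧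
      ∀ n > n₀,
        (∀ ψ : EuclideanSpace ℝ (Fin d), ‖ψ‖ = 1 →
          condFailureProb N β γ μ W k P R n ψ ≤ P.real {ω | (n : ℝ) ^ β * s + η₁ n < R ω}) ∧
        c₃ * P.real {ω | (n : ℝ) ^ β * s + η₂ n < R ω} * (n : ℝ) ^ (-(((d : ℝ) - 1) * β)) ≤
          P.real (failureEvent N β γ μ W k R z n)) ∧
    -- the two bounds at the exact rate: both error terms are `O(1 + k_n)`, hence `o(n ^ β)`
    (∃ (n₀ : ℕ) (c₃ s : ℝ) (η₁ η₂ : ℕ → ℝ), 0 < n₀ ∧ 0 < c₃ ∧ 0 < s ∧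
      (η₁ =O[atTop] fun n : ℕ => 1 + k n) ∧ (η₂ =O[atTop] fun n : ℕ => 1 + k n) ∧
      ∀ n > n₀,
        (∀ ψ : EuclideanSpace ℝ (Fin d), ‖ψ‖ = 1 →
          condFailureProb N β γ μ W k P R n ψ ≤ P.real {ω | (n : ℝ) ^ β * s + η₁ n < R ω}) ∧
        c₃ * P.real {ω | (n : ℝ) ^ β * s + η₂ n < R ω} * (n : ℝ) ^ (-(((d : ℝ) - 1) * β)) ≤
          P.real (failureEvent N β γ μ W k R z n)) ∧
    -- asymptotic optimality of the conditional Monte Carlo estimator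
    AsymptoticallyOptimal P
      (fun n ω => condFailureProb N β γ μ W k P R n (angle (z ω)))
      (fun n => P.real (failureEvent N β γ μ W k R z n)) := by
  have hW' : IsUnit W := by
    rw [Matrix.isUnit_iff_isUnit_det, isUnit_iff_ne_zero]
    intro h
    have hdet := hCov.det_pos
    rw [← hW, Matrix.det_mul, h, zero_mul] at hdet
    exact lt_irrefl _ hdet
  obtain ⟨s, C, K, c, hs, hc, hupper, hlower, hpos⟩ :=
    exists_failure_bounds hd N hpolar hβ hγ μ hW' hk_nonneg
  have hv : Tendsto (fun n : ℕ => (n : ℝ) ^ β) atTop atTop :=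
    (tendsto_rpow_atTop hβ).comp tendsto_natCast_atTop_atTop
  have hone : (fun _ : ℕ => (1 : ℝ)) =o[atTop] fun n : ℕ => (n : ℝ) ^ β :=
    isLittleO_const_left.mpr (Or.inr (tendsto_norm_atTop_atTop.comp hv))
  refine ⟨fun n => condFailureProb_ae_eq_condExp N hpolar β γ μ W k n, ?_, ?_, hpos,
    fun n => memLp_condFailureProb N hpolar β γ μ W k n,
    fun n => integral_condFailureProb N hpolar β γ μ W k n, fun ε hε => ?_⟩
  · obtain ⟨n₁, hn₁⟩ := eventually_atTop.mp
      (((hone.add hk).const_mul_left K).bound one_pos)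
    -- Since `η₁` may be of order `n^β`, the constant is raised to `s + 1`: the extra `n^β`
    -- eventually exceeds `K (1 + k n)`, so `η₂ = 0` works, and `η₁` takes it back in the upper
    -- bound.
    refine ⟨n₁ + 1, c, s + 1, fun n => -(n : ℝ) ^ β - C, fun _ => 0, by omega, hc, by linarith,
      (isBigO_refl _ _).neg_left.sub ((isBigO_const_const C one_ne_zero _).trans hone.isBigO), isBigO_zero _ _, fun n hn =>
      ⟨fun ψ hψ => (hupper n ψ hψ.le).trans_eq ?_, le_trans ?_ (hlower n (by omega))⟩⟩
    · ring_nf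
    · have h1 := hn₁ n (by omega)
      rw [one_mul, Real.norm_of_nonneg (by positivity : (0 : ℝ) ≤ (n : ℝ) ^ β)] at h1
      gcongr c * ?_ * _
      refine antitone_measureReal_lt R ?_
      have := (le_abs_self _).trans h1
      linarith
  · refine ⟨1, c, s, fun _ => -C, fun n => K * (1 + k n), one_pos, hc, hs, ?_,
      isBigO_const_mul_self K _ _, fun n hn =>
      ⟨fun ψ hψ => (hupper n ψ hψ.le).trans_eq (by ring_nf), hlower n (by omega)⟩⟩
    refine IsBigO.of_bound |C| (Eventually.of_forall fun n => ?_)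
    rw [norm_neg, Real.norm_eq_abs, Real.norm_of_nonneg (by linarith [hk_nonneg n])]
    exact le_mul_of_one_le_right (abs_nonneg C) (by linarith [hk_nonneg n])
  · rcases lt_or_ge ε 2 with hε2 | hε2
    · obtain ⟨B, hB⟩ := hpolar.exists_tail_sq_le_rpow (C := C) (K := K) hd hβ hs hc hk hε hε2
      have hev : ∀ᶠ n : ℕ in atTop,
          (∫ ω, condFailureProb N β γ μ W k P R n (angle (z ω)) ^ 2 ∂P) /
            P.real (failureEvent N β γ μ W k R z n) ^ (2 - ε) ≤ |B| := by
        filter_upwards [hB, eventually_gt_atTop 0] with n hn hn0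
        have h1 := hlower n hn0
        rw [div_le_iff₀ (Real.rpow_pos_of_pos (hpos n) _)]
        refine (integral_sq_condFailureProb_le N hpolar β γ μ W k n (hupper n)).trans
          (hn.trans ?_)
        gcongr
        exact le_abs_self B
      -- The finitely many remaining ratios only enlarge the bound.
      obtain ⟨C', hC'⟩ := exists_forall_le_of_eventually hev
      exact ⟨C', fun n _ => hC' n⟩
    -- For `ε ≥ 2` the exponent is nonpositive, so the denominator is at least 1.
    · refine ⟨1, fun n _ => div_le_one_of_le₀ ?_ (Real.rpow_nonneg measureReal_nonneg _)⟩
      have h1 := integral_sq_condFailureProb_le N hpolar β γ μ W k n (q := 1)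
        fun ψ _ => condFailureProb_le_one N β γ μ W k n ψ
      rw [one_pow] at h1
      exact h1.trans
        (Real.one_le_rpow_of_pos_of_le_one_of_nonpos (hpos n) measureReal_le_one (by linarith))
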